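/- Let $X$, $Y$, $\partial X$ be complex Banach spaces with $Y\hookrightarrow X$ (a continuous injective linear embedding, by which $Y$ is regarded as a subspace of $X$). Let $A:D(A)\to X$ be linear with $D(A)\subset Y$, let $R:D(A)\to\partial X$ be linear and surjective, and let $B_1,B_2\in\mathcal L(Y,\partial X)$ and $B_3,B_4\in\mathcal L(\partial X)$. Assume that $\binom{A}{R}:D(A)\subset Y\to X\times\partial X$ is closed, and that $A_0:=A|_{\ker R}$ generates a cosine operator function on $X$ with associated phase space $Y\times X$ (that is, moreover $\begin{pmatrix}0&I_Y\\A_0&0\end{pmatrix}$ with domain $D(A_0)\times Y$ generates a $C_0$-semigroup on $Y\times X$). Put $L:=R+B_2:D(A)\to\partial X$ and $\mathbb X:=Y\times X\times\partial X$. Define $$\mathbb A:=\begin{pmatrix}0&I_Y&0\\A&0&0\\L&0&0\end{pmatrix},\quad D(\mathbb A):=D(A)\times Y\times\partial X,\qquad \mathbb R:=\begin{pmatrix}R&0&0\end{pmatrix}:D(\mathbb A)\to\partial X,$$ $$\mathbb B:=\begin{pmatrix}B_1+B_4B_2&0&B_3\end{pmatrix}:\mathbb X\to\partial X,\qquad \mathbb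 A_0:=\mathbb A|_{\ker\mathbb R}\ \text{ on }\mathbb X,$$ and, on $\mathcal X:=\mathbb X\times\partial X$, the operator $$\mathcal A:=\begin{pmatrix}\mathbb A&0\\\mathbb B&B_4\end{pmatrix},\qquad D(\mathcal A):=\left\{\binom{\mathbb u}{\mathbb x}\in D(\mathbb A)\times\partial X:\ \mathbb R\mathbb u=\mathbb x\right\}.$$ For an operator $T$ on a Banach space let $\sigma_{\rm ess}(T)$ be the set of $\mu\in\mathbb C$ for which $T-\mu$ is not Fredholm, where an operator is Fredholm if it is closed, its kernel is finite dimensional, and its range is closed and of finite codimension; its index is $\operatorname{ind}=\dim\ker-\operatorname{codim}\operatorname{range}$. If $\partial X$ is finite dimensional, then $$\sigma_{\rm ess}(\mathcal A)=\sigma_{\rm ess}(\mathbb A_0),$$ and $$\operatorname{ind}(\mathcal A-\mu)=\operatorname{ind}(\mathbb A_0-\mu)\qquad\text{for all }\mu\notin\sigma_{\rm ess}(\mathbb A_0).$$ -/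

import Mathlib

open Filter Topology
open scoped NNReal

noncomputable section

namespace Acoustic

/-! ### Generators of semigroups and of cosine functions -/

section Generators

variable {E : Type*} [NormedAddCommGroup E] [NormedSpace ℂ E]

/-- Strongly continuous one-parameter semigroups of bounded operators. -/
structure IsC0Semigroup (T : ℝ≥0 → E →L[ℂ] E) : Prop where
  zero : T 0 = ContinuousLinearMap.id ℂ E
  add : ∀ s t, T (s + t) = (T s).comp (T t)
  strongly_continuous : ∀ x, Continuous fun t => T t x

/-- `G` generates a strongly continuous semigroup `T`: the domain of `G` consists exactly of the
`x` for which `(T t x - x) / t` converges as `t ↓ 0`, and the limit is `G x`. -/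
def GeneratesC0Semigroup (G : E →ₗ.[ℂ] E) : Prop :=
  ∃ T : ℝ≥0 → E →L[ℂ] E, IsC0Semigroup T ∧
    ∀ x y : E, (x, y) ∈ G.graph ↔
      Tendsto (fun t : ℝ≥0 => (((t : ℝ)⁻¹ : ℝ) : ℂ) • (T t x - x)) (𝓝[>] 0) (𝓝 y)

/-- Strongly continuous cosine operator functions. -/
structure IsCosineFunction (C : ℝ → E →L[ℂ] E) : Prop where
  zero : C 0 = ContinuousLinearMap.id ℂ E
  dAlembert : ∀ s t, C (t + s) + C (t - s) = (2 : ℂ) • (C t).comp (C s)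
  strongly_continuous : ∀ x, Continuous fun t => C t x

/-- `G` generates a cosine operator function `C`: the domain of `G` consists exactly of the
`x` for which `2 (C t x - x) / t ^ 2` converges as `t → 0`, and the limit is `G x`. -/
def GeneratesCosineFunction (G : E →ₗ.[ℂ] E) : Prop :=
  ∃ C : ℝ → E →L[ℂ] E, IsCosineFunction C ∧
    ∀ x y : E, (x, y) ∈ G.graph ↔
      Tendsto (fun t : ℝ => ((2 / t ^ 2 : ℝ) : ℂ) • (C t x - x)) (𝓝[≠] 0) (𝓝 y)

end Generators

/-! ### Unbounded Fredholm operators and the essential spectrum -/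

section Fredholm

variable {E F : Type*} [NormedAddCommGroup E] [NormedSpace ℂ E]
  [NormedAddCommGroup F] [NormedSpace ℂ F]

/-- The operator `T - μ`, with the same domain as `T`. -/
def subScalar (T : E →ₗ.[ℂ] E) (μ : ℂ) : E →ₗ.[ℂ] E :=
  ⟨T.domain, T.toFun - μ • T.domain.subtype⟩

/-- A (possibly unbounded) operator is Fredholm if it is closed, has a finite-dimensional kernel,
and its range is closed and of finite codimension. -/
structure IsFredholm (T : E →ₗ.[ℂ] F) : Prop where
  closed : T.IsClosed
  finite_ker : FiniteDimensional ℂ (LinearMap.ker T.toFun)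
  closed_range : IsClosed (LinearMap.range T.toFun : Set F)
  finite_coker : FiniteDimensional ℂ (F ⧸ LinearMap.range T.toFun)

/-- The Fredholm index `dim ker T - codim range T` (meaningful for Fredholm operators). -/
def fredholmIndex (T : E →ₗ.[ℂ] F) : ℤ :=
  (Module.finrank ℂ (LinearMap.ker T.toFun) : ℤ) -
    (Module.finrank ℂ (F ⧸ LinearMap.range T.toFun) : ℤ)

/-- The essential spectrum: all `μ` such that `T - μ` is not Fredholm. -/
def essentialSpectrum (T : E →ₗ.[ℂ] E) : Set ℂ :=
  {μ | ¬ IsFredholm (subScalar T μ)}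

end Fredholm

/-! ### The abstract setting -/

/-- The spaces and operators: an embedding `ι : Y ↪ X`, a linear operator `A : D(A) → X` with
`D(A) ⊆ Y`, a linear operator `R : D(A) → ∂X` and bounded operators `B₁, B₂ : Y → ∂X`,
`B₃, B₄ : ∂X → ∂X`. The boundary space `∂X` is called `dX`. -/
structure Data (X Y dX : Type*)
    [NormedAddCommGroup X] [NormedSpace ℂ X] [NormedAddCommGroup Y] [NormedSpace ℂ Y]
    [NormedAddCommGroup dX] [NormedSpace ℂ dX] where
  ι : Y →L[ℂ] X
  ι_injective : Function.Injective ι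
  A : Y →ₗ.[ℂ] X
  R : A.domain →ₗ[ℂ] dX
  B₁ : Y →L[ℂ] dX
  B₂ : Y →L[ℂ] dX
  B₃ : dX →L[ℂ] dX
  B₄ : dX →L[ℂ] dX

namespace Data

variable {X Y dX : Type*}
  [NormedAddCommGroup X] [NormedSpace ℂ X] [NormedAddCommGroup Y] [NormedSpace ℂ Y]
  [NormedAddCommGroup dX] [NormedSpace ℂ dX] (S : Data X Y dX)

/-- `Y` regarded as a subspace of `X`. -/
def YinX : Submodule ℂ X := LinearMap.range (S.ι : Y →ₗ[ℂ] X)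

/-- The identification of the subspace `Y` of `X` with the Banach space `Y`. -/
def toY : S.YinX →ₗ[ℂ] Y :=
  (LinearEquiv.ofInjective (S.ι : Y →ₗ[ℂ] X) S.ι_injective).symm.toLinearMap

/-- `L = R + B₂` on `D(A)`. -/
def L : S.A.domain →ₗ[ℂ] dX := S.R + (S.B₂ : Y →ₗ[ℂ] dX).comp S.A.domain.subtype

/-- The operator `(A, R) : D(A) ⊆ Y → X × ∂X`. -/
def AR : Y →ₗ.[ℂ] X × dX := ⟨S.A.domain, S.A.toFun.prod S.R⟩

/-- The subspace `ker R` of `Y`. -/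
def kerR : Submodule ℂ Y := (LinearMap.ker S.R).map S.A.domain.subtype

/-- The restriction of `A` to `ker R`, as an operator from `Y` to `X`. -/
def A₀Y : Y →ₗ.[ℂ] X := S.A.domRestrict S.kerR

/-- The restriction `A₀` of `A` to `ker R`, as an operator on `X`. -/
def A₀ : X →ₗ.[ℂ] X :=
  ⟨S.A₀Y.domain.map (S.ι : Y →ₗ[ℂ] X),
    S.A₀Y.toFun.comp
      (Submodule.equivMapOfInjective (S.ι : Y →ₗ[ℂ] X) S.ι_injective
        S.A₀Y.domain).symm.toLinearMap⟩

/-- The operator matrix `(0, I_Y; A₀, 0)` on `Y × X` with domain `D(A₀) × Y`. -/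
def phaseOperator : Y × X →ₗ.[ℂ] Y × X where
  domain := S.A₀Y.domain.prod S.YinX
  toFun :=
    (S.toY.comp
        (((LinearMap.snd ℂ Y X).comp (S.A₀Y.domain.prod S.YinX).subtype).codRestrict
          S.YinX fun p => p.2.2)).prod
      (S.A₀Y.toFun.comp
        (((LinearMap.fst ℂ Y X).comp (S.A₀Y.domain.prod S.YinX).subtype).codRestrict
          S.A₀Y.domain fun p => p.2.1))

/-- `A₀` generates a cosine operator function on `X` with associated phase space `Y × X`.
The second factor `X` being fixed, the phase space is characterized by the property that
`(0, I_Y; A₀, 0)` with domain `D(A₀) × Y` generates a strongly continuous semigroup on it. -/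
def HasPhaseSpace : Prop :=
  GeneratesCosineFunction S.A₀ ∧ GeneratesC0Semigroup S.phaseOperator

/-- The standing assumptions on the data: besides what is built into `Data`, the operator `R` is
surjective, `(A, R)` is closed, and `A₀` generates a cosine function with phase space `Y × X`. -/
structure Assumptions : Prop where
  R_surjective : Function.Surjective S.R
  AR_closed : S.AR.IsClosed
  phase_space : S.HasPhaseSpace

/-- The domain `D(A) × Y × ∂X` of the operator matrix `𝔸`. -/
def bbDomain : Submodule ℂ (Y × X × dX) :=
  S.A.domain.prod (S.YinX.prod ⊤)

/-- The first coordinate `D(𝔸) → D(A)`. -/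
def bbFst : S.bbDomain →ₗ[ℂ] S.A.domain :=
  ((LinearMap.fst ℂ Y (X × dX)).comp S.bbDomain.subtype).codRestrict S.A.domain fun p => p.2.1

/-- The second coordinate `D(𝔸) → Y ⊆ X`. -/
def bbSnd : S.bbDomain →ₗ[ℂ] S.YinX :=
  ((LinearMap.fst ℂ X dX).comp
    ((LinearMap.snd ℂ Y (X × dX)).comp S.bbDomain.subtype)).codRestrict S.YinX fun p => p.2.2.1

/-- The operator matrix `𝔸 = (0, I_Y, 0; A, 0, 0; L, 0, 0)` on `𝕏 = Y × X × ∂X`,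
that is `(u, v, x) ↦ (v, A u, L u)`, with domain `D(A) × Y × ∂X`. -/
def bbA : Y × X × dX →ₗ.[ℂ] Y × X × dX :=
  ⟨S.bbDomain, (S.toY.comp S.bbSnd).prod ((S.A.toFun.comp S.bbFst).prod (S.L.comp S.bbFst))⟩

/-- The operator `ℝ = (R, 0, 0) : D(𝔸) → ∂X`. -/
def bbR : Y × X × dX →ₗ.[ℂ] dX := ⟨S.bbDomain, S.R.comp S.bbFst⟩

/-- The bounded operator `𝔹 = (B₁ + B₄ B₂, 0, B₃) : 𝕏 → ∂X`. -/
def bbB : Y × X × dX →L[ℂ] dX :=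
  (S.B₁ + S.B₄.comp S.B₂).comp (ContinuousLinearMap.fst ℂ Y (X × dX)) +
    S.B₃.comp ((ContinuousLinearMap.snd ℂ X dX).comp (ContinuousLinearMap.snd ℂ Y (X × dX)))

/-- The restriction `𝔸₀` of `𝔸` to `ker ℝ`. -/
def bbA₀ : Y × X × dX →ₗ.[ℂ] Y × X × dX :=
  S.bbA.domRestrict ((LinearMap.ker S.bbR.toFun).map S.bbR.domain.subtype)

/-- The operator matrix `𝒜 = (𝔸, 0; 𝔹, B₄)` on `𝒳 = 𝕏 × ∂X` with domain
`{(u, x) | u ∈ D(𝔸), ℝ u = x}`, i.e. the graph of `ℝ`. -/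
def calA : (Y × X × dX) × dX →ₗ.[ℂ] (Y × X × dX) × dX where
  domain := S.bbR.graph
  toFun :=
    (S.bbA.toFun.comp
        (((LinearMap.fst ℂ (Y × X × dX) dX).comp S.bbR.graph.subtype).codRestrict
          S.bbA.domain fun p => LinearPMap.mem_domain_of_mem_graph (f := S.bbR) p.2)).prod
      (((S.bbB : Y × X × dX →ₗ[ℂ] dX).coprod (S.B₄ : dX →ₗ[ℂ] dX)).comp S.bbR.graph.subtype)

end Data

end Acoustic

end

/-!
Up to the identification of its domain with `D(𝔸)`, the operator `𝒜 - μ` is `𝔸 - μ` with one more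
component in the target, of dimension `dim ∂X`; this lowers the index by `dim ∂X`, whatever the
bounded operators in the last row are. The operator `𝔸₀ - μ` is the restriction of `𝔸 - μ` to the
kernel of `ℝ`; this lowers the index by the rank of `ℝ`, which is `dim ∂X` when `ℝ` is surjective.
Neither modification affects the finiteness of kernel and cokernel, and since both operators are
closed, the open mapping theorem supplies the closed range.
-/

namespace Acoustic

open Module

section FiniteIndex

variable {K U V W : Type*} [DivisionRing K] [AddCommGroup U] [Module K U]
  [AddCommGroup V] [Module K V] [AddCommGroup W] [Module K W]

/-- The algebraic part of the Fredholm property: finite-dimensional kernel and cokernel. These are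
the linear maps for which `LinearMap.index` is meaningful. -/
structure HasFiniteIndex (f : U →ₗ[K] V) : Prop where
  finite_ker : FiniteDimensional K (LinearMap.ker f)
  finite_coker : (LinearMap.range f).CoFG

namespace HasFiniteIndex

variable {f : U →ₗ[K] V} {g : V →ₗ[K] W}

lemma of_injective (hf : Function.Injective f) (hrange : (LinearMap.range f).CoFG) :
    HasFiniteIndex f :=
  ⟨by rw [LinearMap.ker_eq_bot.2 hf]; infer_instance, hrange⟩

lemma of_surjective (hf : Function.Surjective f) (hker : FiniteDimensional K (LinearMap.ker f)) :
    HasFiniteIndex f :=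
  ⟨hker, by rw [LinearMap.range_eq_top.2 hf]; exact .top⟩

lemma of_linearEquiv (e : U ≃ₗ[K] V) : HasFiniteIndex e.toLinearMap :=
  .of_injective e.injective (by rw [e.range]; exact .top)

lemma comp (hg : HasFiniteIndex g) (hf : HasFiniteIndex f) : HasFiniteIndex (g ∘ₗ f) := by
  have := hf.finite_ker
  have := hf.finite_coker
  have := hg.finite_ker
  have := hg.finite_coker
  exact ⟨by rw [LinearMap.ker_comp]; infer_instance, by rw [LinearMap.range_comp]; infer_instance⟩

lemma index_comp (hg : HasFiniteIndex g) (hf : HasFiniteIndex f) :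
    (g ∘ₗ f).index = g.index + f.index := by
  have := hf.finite_ker
  have := hf.finite_coker
  have := hg.finite_ker
  have := hg.finite_coker
  exact LinearMap.index_comp g

lemma of_comp_left (hf : (LinearMap.range f).CoFG) (h : HasFiniteIndex (g ∘ₗ f)) :
    HasFiniteIndex g := by
  have := h.finite_ker
  refine ⟨?_, h.finite_coker.of_le (LinearMap.range_comp_le_range f g)⟩
  have exact_ker_coker :
      LinearMap.range (f.restrict (p := LinearMap.ker (g ∘ₗ f)) (q := LinearMap.ker g) (by simp)) =
        LinearMap.ker ((LinearMap.range f).mkQ ∘ₗ (LinearMap.ker g).subtype) := by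
    ext ⟨v, hv⟩
    simp only [LinearMap.mem_range, LinearMap.ker_comp, Submodule.ker_mkQ, Submodule.mem_comap,
      Submodule.subtype_apply, Subtype.exists, Subtype.ext_iff]
    exact exists_congr fun u => ⟨fun ⟨_, hu⟩ => hu, fun hu => ⟨hu ▸ hv, hu⟩⟩
  have := isNoetherian_of_range_eq_ker _ _ exact_ker_coker
  infer_instance

lemma of_comp_right (hg : FiniteDimensional K (LinearMap.ker g)) (h : HasFiniteIndex (g ∘ₗ f)) :
    HasFiniteIndex f := by
  have := h.finite_ker
  have := h.finite_coker
  refine ⟨Submodule.finiteDimensional_of_le (LinearMap.ker_le_ker_comp f g), ?_⟩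
  have range_le : LinearMap.range f ≤ (LinearMap.range (g ∘ₗ f)).comap g := by
    rw [← Submodule.map_le_iff_le_comap, LinearMap.range_comp]
  have exact_coker :
      LinearMap.range ((LinearMap.range f).mkQ ∘ₗ (LinearMap.ker g).subtype) =
        LinearMap.ker ((LinearMap.range f).mapQ (LinearMap.range (g ∘ₗ f)) g range_le) := by
    simp [LinearMap.range_comp, Submodule.ker_mapQ, Submodule.comap_map_eq]
  have := isNoetherian_of_range_eq_ker _ _ exact_coker
  infer_instance

end HasFiniteIndex

lemma hasFiniteIndex_comp_iff_of_injective {j : U →ₗ[K] V} (hj : Function.Injective j)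
    (hrange : (LinearMap.range j).CoFG) (f : V →ₗ[K] W) :
    HasFiniteIndex (f ∘ₗ j) ↔ HasFiniteIndex f :=
  ⟨.of_comp_left hrange, fun hf => hf.comp (.of_injective hj hrange)⟩

lemma index_comp_of_injective {j : U →ₗ[K] V} (hj : Function.Injective j)
    (hrange : (LinearMap.range j).CoFG) {f : V →ₗ[K] W} (hf : HasFiniteIndex f) :
    (f ∘ₗ j).index = f.index - finrank K (V ⧸ LinearMap.range j) := by
  rw [hf.index_comp (.of_injective hj hrange), LinearMap.index_of_injective hj, sub_eq_add_neg]

lemma hasFiniteIndex_comp_linearEquiv_iff (f : V →ₗ[K] W) (e : U ≃ₗ[K] V) :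
    HasFiniteIndex (f ∘ₗ e.toLinearMap) ↔ HasFiniteIndex f :=
  hasFiniteIndex_comp_iff_of_injective e.injective (HasFiniteIndex.of_linearEquiv e).finite_coker f

lemma index_comp_linearEquiv {f : V →ₗ[K] W} (hf : HasFiniteIndex f) (e : U ≃ₗ[K] V) :
    (f ∘ₗ e.toLinearMap).index = f.index := by
  rw [hf.index_comp (.of_linearEquiv e), LinearEquiv.index_eq_zero, add_zero]

variable {Z : Type*} [AddCommGroup Z] [Module K Z]

lemma index_fst : (LinearMap.fst K W Z).index = finrank K Z := by
  rw [LinearMap.index_of_surjective LinearMap.fst_surjective, LinearMap.ker_fst,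
    LinearMap.finrank_range_of_inj LinearMap.inr_injective]

variable [FiniteDimensional K Z]

lemma hasFiniteIndex_fst : HasFiniteIndex (LinearMap.fst K W Z) :=
  .of_surjective LinearMap.fst_surjective (by rw [LinearMap.ker_fst]; infer_instance)

lemma hasFiniteIndex_prod_iff {f : V →ₗ[K] W} {g : V →ₗ[K] Z} :
    HasFiniteIndex (f.prod g) ↔ HasFiniteIndex f := by
  refine ⟨fun h => LinearMap.fst_prod f g ▸ hasFiniteIndex_fst.comp h, fun h => ?_⟩
  exact .of_comp_right hasFiniteIndex_fst.finite_ker ((LinearMap.fst_prod f g).symm ▸ h)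

lemma index_prod {f : V →ₗ[K] W} (hf : HasFiniteIndex f) (g : V →ₗ[K] Z) :
    (f.prod g).index = f.index - finrank K Z := by
  have h := hasFiniteIndex_fst.index_comp (hasFiniteIndex_prod_iff (g := g).2 hf)
  rw [LinearMap.fst_prod, index_fst] at h
  lia

end FiniteIndex

section ClosedRange

variable {𝕜 E F : Type*} [NontriviallyNormedField 𝕜] [CompleteSpace 𝕜]
  [NormedAddCommGroup E] [NormedSpace 𝕜 E] [CompleteSpace E]
  [NormedAddCommGroup F] [NormedSpace 𝕜 F] [CompleteSpace F]

lemma isClosed_range_of_coFG (u : E →L[𝕜] F) (hu : u.range.CoFG) : IsClosed (u.range : Set F) := by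
  have : IsClosed (u.ker : Set E) := u.isClosed_ker
  obtain ⟨G, hG⟩ := u.range.exists_isCompl
  have : FiniteDimensional 𝕜 G := Module.Finite.iff_fg.2 (hu.fg_of_isCompl hG)
  let v : E ⧸ u.ker →L[𝕜] F := u.ker.liftQL u le_rfl
  have ker_v : v.ker = ⊥ := Submodule.ker_liftQ_eq_bot _ _ _ le_rfl
  have range_v : v.range = u.range := Submodule.range_liftQ _ _ _
  rw [← range_v] at hG ⊢
  exact v.closed_complemented_range_of_isCompl_of_ker_eq_bot G hG G.closed_of_finiteDimensional
    ker_v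

lemma isClosed_range_of_isClosed_of_coFG {T : E →ₗ.[𝕜] F} (hT : T.IsClosed)
    (hrange : (LinearMap.range T.toFun).CoFG) : IsClosed (LinearMap.range T.toFun : Set F) := by
  have : CompleteSpace T.graph := hT.completeSpace_coe
  let u : T.graph →L[𝕜] F := (ContinuousLinearMap.snd 𝕜 E F).comp T.graph.subtypeL
  have range_u : u.range = LinearMap.range T.toFun := by
    rw [← T.graph_map_snd_eq_range, ← LinearMap.range_domRestrict]
    rfl
  rw [← range_u] at hrange ⊢
  exact isClosed_range_of_coFG u hrange

end ClosedRange

section Fredholm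

variable {E F : Type*} [NormedAddCommGroup E] [NormedSpace ℂ E]
  [NormedAddCommGroup F] [NormedSpace ℂ F]

lemma isFredholm_iff_hasFiniteIndex [CompleteSpace E] [CompleteSpace F] {T : E →ₗ.[ℂ] F}
    (hT : T.IsClosed) : IsFredholm T ↔ HasFiniteIndex T.toFun :=
  ⟨fun h => ⟨h.finite_ker, h.finite_coker⟩, fun h =>
    ⟨hT, h.finite_ker, isClosed_range_of_isClosed_of_coFG hT h.finite_coker, h.finite_coker⟩⟩

lemma fredholmIndex_eq_index (T : E →ₗ.[ℂ] F) : fredholmIndex T = T.toFun.index :=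
  LinearMap.index_eq_finrank_sub.symm

end Fredholm

section BoundaryCoupling

variable {E F Z : Type*} [NormedAddCommGroup E] [NormedSpace ℂ E]
  [NormedAddCommGroup F] [NormedSpace ℂ F] [NormedAddCommGroup Z] [NormedSpace ℂ Z]

/-- An operator `A` together with a boundary operator `R` on the same domain, as the operator
`x ↦ (A x, R x)`. -/
def boundaryPair (A : E →ₗ.[ℂ] F) (R : A.domain →ₗ[ℂ] Z) : E →ₗ.[ℂ] F × Z :=
  ⟨A.domain, A.toFun.prod R⟩

/-- The operator `A` with the homogeneous boundary condition `R x = 0`. -/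
noncomputable def restrictKer (A : E →ₗ.[ℂ] F) (R : A.domain →ₗ[ℂ] Z) : E →ₗ.[ℂ] F :=
  A.domRestrict ((LinearMap.ker R).map A.domain.subtype)

/-- The identification of the graph of an operator with its domain. -/
noncomputable def graphEquivDomain (T : E →ₗ.[ℂ] F) : T.graph ≃ₗ[ℂ] T.domain :=
  LinearEquiv.ofBijective
    (((LinearMap.fst ℂ E F).comp T.graph.subtype).codRestrict T.domain fun p =>
      LinearPMap.mem_domain_of_mem_graph p.2)
    ⟨fun p q h => Subtype.ext (Prod.ext (congrArg Subtype.val h)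
        (T.mem_graph_snd_inj p.2 q.2 (congrArg Subtype.val h))),
      fun x => ⟨⟨(x, T x), T.mem_graph x⟩, rfl⟩⟩

/-- The operator matrix `(A, 0; B, C)` with coupled domain: `(x, z) ↦ (A x, B x + C z)` on the pairs
with `x` in the domain of `A` and `R x = z`, that is on the graph of `R`. -/
noncomputable def coupledMatrix (A : E →ₗ.[ℂ] F) (R : A.domain →ₗ[ℂ] Z) (B : E →L[ℂ] Z)
    (C : Z →L[ℂ] Z) : E × Z →ₗ.[ℂ] F × Z where
  domain := (LinearPMap.mk A.domain R).graph
  toFun := (A.toFun ∘ₗ (graphEquivDomain ⟨A.domain, R⟩).toLinearMap).prod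
    ((B : E →ₗ[ℂ] Z).coprod (C : Z →ₗ[ℂ] Z) ∘ₗ (LinearPMap.mk A.domain R).graph.subtype)

variable {A : E →ₗ.[ℂ] F} {R : A.domain →ₗ[ℂ] Z} {B : E →L[ℂ] Z} {C : Z →L[ℂ] Z}

lemma mem_graph_boundaryPair {x : E} {y : F} {z : Z} :
    (x, (y, z)) ∈ (boundaryPair A R).graph ↔ ∃ h : x ∈ A.domain, A ⟨x, h⟩ = y ∧ R ⟨x, h⟩ = z := by
  rw [LinearPMap.mem_graph_iff]
  constructor
  · rintro ⟨u, rfl, h⟩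
    exact ⟨u.2, congrArg Prod.fst h, congrArg Prod.snd h⟩
  · rintro ⟨h, rfl, rfl⟩
    exact ⟨⟨x, h⟩, rfl, rfl⟩

lemma mem_graph_restrictKer {x : E} {y : F} :
    (x, y) ∈ (restrictKer A R).graph ↔ (x, (y, 0)) ∈ (boundaryPair A R).graph := by
  rw [mem_graph_boundaryPair, LinearPMap.mem_graph_iff]
  constructor
  · rintro ⟨⟨_, ⟨u, hu, rfl⟩, hx⟩, rfl, rfl⟩
    exact ⟨hx, rfl, hu⟩
  · rintro ⟨hx, rfl, hR⟩
    exact ⟨⟨x, ⟨⟨x, hx⟩, hR, rfl⟩, hx⟩, rfl, rfl⟩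

lemma mem_graph_coupledMatrix {x : E} {y : F} {z w : Z} :
    ((x, z), (y, w)) ∈ (coupledMatrix A R B C).graph ↔
      (x, (y, z)) ∈ (boundaryPair A R).graph ∧ w = B x + C z := by
  rw [mem_graph_boundaryPair, LinearPMap.mem_graph_iff]
  constructor
  · rintro ⟨⟨_, hp⟩, rfl, h⟩
    obtain ⟨u, rfl, rfl⟩ := (LinearPMap.mem_graph_iff _).1 hp
    exact ⟨⟨u.2, congrArg Prod.fst h, rfl⟩, (congrArg Prod.snd h).symm⟩
  · rintro ⟨⟨hx, rfl, rfl⟩, rfl⟩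
    exact ⟨⟨_, LinearPMap.mem_graph ⟨A.domain, R⟩ ⟨x, hx⟩⟩, rfl, rfl⟩

lemma isClosed_restrictKer (h : (boundaryPair A R).IsClosed) : (restrictKer A R).IsClosed := by
  have graph_eq : ((restrictKer A R).graph : Set (E × F)) =
      (fun p => (p.1, (p.2, 0))) ⁻¹' ((boundaryPair A R).graph : Set (E × F × Z)) :=
    Set.ext fun _ => mem_graph_restrictKer
  rw [LinearPMap.IsClosed, graph_eq]
  exact h.preimage (by fun_prop)

lemma isClosed_coupledMatrix (h : (boundaryPair A R).IsClosed) :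
    (coupledMatrix A R B C).IsClosed := by
  have graph_eq : ((coupledMatrix A R B C).graph : Set ((E × Z) × (F × Z))) =
      (fun p => (p.1.1, (p.2.1, p.1.2))) ⁻¹' ((boundaryPair A R).graph : Set (E × F × Z)) ∩
        {p | p.2.2 = B p.1.1 + C p.1.2} :=
    Set.ext fun _ => mem_graph_coupledMatrix
  rw [LinearPMap.IsClosed, graph_eq]
  exact (h.preimage (by fun_prop)).inter (isClosed_eq (by fun_prop) (by fun_prop))

variable (A R) in
/-- The inclusion of the domain of `restrictKer A R` into the domain of `A`. -/
noncomputable def restrictKer.incl : (restrictKer A R).domain →ₗ[ℂ] A.domain :=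
  Submodule.inclusion inf_le_right

lemma restrictKer.incl_injective : Function.Injective (restrictKer.incl A R) :=
  Submodule.inclusion_injective _

lemma restrictKer.range_incl : LinearMap.range (restrictKer.incl A R) = LinearMap.ker R := by
  refine (Submodule.range_inclusion _ _ _).trans ?_
  rw [restrictKer, LinearPMap.domRestrict_domain, Submodule.comap_inf, Submodule.comap_subtype_self,
    inf_top_eq, Submodule.comap_map_eq_of_injective A.domain.injective_subtype]

lemma toFun_restrictKer : (restrictKer A R).toFun = A.toFun ∘ₗ restrictKer.incl A R :=
  rfl

variable (A R B C) in
/-- The identification of the domain of `coupledMatrix A R B C` with the domain of `A`. -/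
noncomputable def coupledMatrix.domainEquiv : (coupledMatrix A R B C).domain ≃ₗ[ℂ] A.domain :=
  graphEquivDomain ⟨A.domain, R⟩

lemma toFun_coupledMatrix :
    (coupledMatrix A R B C).toFun =
      A.toFun.prod ((B : E →ₗ[ℂ] Z) ∘ₗ A.domain.subtype + (C : Z →ₗ[ℂ] Z) ∘ₗ R) ∘ₗ
        (coupledMatrix.domainEquiv A R B C).toLinearMap := by
  refine LinearMap.ext fun ⟨⟨x, z⟩, hp⟩ => ?_
  obtain ⟨u, rfl, rfl⟩ := (LinearPMap.mem_graph_iff _).1 hp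
  rfl

variable [FiniteDimensional ℂ Z]

lemma restrictKer.coFG_range_incl : (LinearMap.range (restrictKer.incl A R)).CoFG := by
  rw [restrictKer.range_incl]
  exact .ker R

lemma hasFiniteIndex_restrictKer_iff :
    HasFiniteIndex (restrictKer A R).toFun ↔ HasFiniteIndex A.toFun :=
  hasFiniteIndex_comp_iff_of_injective restrictKer.incl_injective restrictKer.coFG_range_incl
    A.toFun

lemma index_restrictKer (hA : HasFiniteIndex A.toFun) :
    (restrictKer A R).toFun.index = A.toFun.index - finrank ℂ (LinearMap.range R) := by
  rw [toFun_restrictKer, index_comp_of_injective restrictKer.incl_injective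
    restrictKer.coFG_range_incl hA, restrictKer.range_incl, R.quotKerEquivRange.finrank_eq]

lemma hasFiniteIndex_coupledMatrix_iff :
    HasFiniteIndex (coupledMatrix A R B C).toFun ↔ HasFiniteIndex A.toFun := by
  rw [toFun_coupledMatrix, hasFiniteIndex_comp_linearEquiv_iff, hasFiniteIndex_prod_iff]

lemma index_coupledMatrix (hA : HasFiniteIndex A.toFun) :
    (coupledMatrix A R B C).toFun.index = A.toFun.index - finrank ℂ Z := by
  rw [toFun_coupledMatrix, index_comp_linearEquiv (hasFiniteIndex_prod_iff.2 hA), index_prod hA]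

lemma fredholmIndex_coupledMatrix_add (h : IsFredholm (restrictKer A R)) :
    fredholmIndex (coupledMatrix A R B C) + finrank ℂ (Z ⧸ LinearMap.range R) =
      fredholmIndex (restrictKer A R) := by
  have hA : HasFiniteIndex A.toFun :=
    hasFiniteIndex_restrictKer_iff.1 ⟨h.finite_ker, h.finite_coker⟩
  have := (LinearMap.range R).finrank_quotient_add_finrank
  rw [fredholmIndex_eq_index, fredholmIndex_eq_index, index_coupledMatrix hA, index_restrictKer hA]
  lia

lemma isFredholm_coupledMatrix_iff [CompleteSpace E] [CompleteSpace F]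
    (h : (boundaryPair A R).IsClosed) :
    IsFredholm (coupledMatrix A R B C) ↔ IsFredholm (restrictKer A R) := by
  have : CompleteSpace Z := FiniteDimensional.complete ℂ Z
  have closed : (coupledMatrix A R B C).IsClosed := isClosed_coupledMatrix h
  have coupled_iff : IsFredholm (coupledMatrix A R B C) ↔ HasFiniteIndex A.toFun :=
    (isFredholm_iff_hasFiniteIndex closed).trans hasFiniteIndex_coupledMatrix_iff
  have restrict_iff : IsFredholm (restrictKer A R) ↔ HasFiniteIndex A.toFun :=
    (isFredholm_iff_hasFiniteIndex (isClosed_restrictKer h)).trans hasFiniteIndex_restrictKer_iff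
  exact coupled_iff.trans restrict_iff.symm

end BoundaryCoupling

section Shift

variable {E Z : Type*} [NormedAddCommGroup E] [NormedSpace ℂ E] [NormedAddCommGroup Z]
  [NormedSpace ℂ Z] {A : E →ₗ.[ℂ] E} {R : A.domain →ₗ[ℂ] Z} {B : E →L[ℂ] Z} {C : Z →L[ℂ] Z}

lemma isClosed_boundaryPair_subScalar (h : (boundaryPair A R).IsClosed) (μ : ℂ) :
    (boundaryPair (subScalar A μ) R).IsClosed := by
  have graph_eq : ((boundaryPair (subScalar A μ) R).graph : Set (E × E × Z)) =
      (fun p => (p.1, (p.2.1 + μ • p.1, p.2.2))) ⁻¹' (boundaryPair A R).graph := by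
    ext ⟨x, y, z⟩
    have shift_iff : (∃ h : x ∈ A.domain, A ⟨x, h⟩ - μ • x = y ∧ R ⟨x, h⟩ = z) ↔
        ∃ h : x ∈ A.domain, A ⟨x, h⟩ = y + μ • x ∧ R ⟨x, h⟩ = z := by
      simp only [sub_eq_iff_eq_add]
    exact mem_graph_boundaryPair.trans (shift_iff.trans mem_graph_boundaryPair.symm)
  rw [LinearPMap.IsClosed, graph_eq]
  exact h.preimage (by fun_prop)

lemma subScalar_restrictKer (μ : ℂ) :
    subScalar (restrictKer A R) μ = restrictKer (subScalar A μ) R :=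
  rfl

lemma subScalar_coupledMatrix (μ : ℂ) :
    subScalar (coupledMatrix A R B C) μ =
      coupledMatrix (subScalar A μ) R B (C - μ • ContinuousLinearMap.id ℂ Z) := by
  refine LinearPMap.ext rfl fun ⟨x, z⟩ _ _ => Prod.ext rfl ?_
  exact add_sub_assoc (B x) (C z) (μ • z)

end Shift

namespace Data

variable {X Y dX : Type*}
  [NormedAddCommGroup X] [NormedSpace ℂ X] [NormedAddCommGroup Y] [NormedSpace ℂ Y]
  [NormedAddCommGroup dX] [NormedSpace ℂ dX] (S : Data X Y dX)

/-- The operator `ℝ` typed as a linear map on `S.bbA.domain`, which agrees with `S.bbR.domain` only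
after unfolding. -/
noncomputable def boundaryMap : S.bbA.domain →ₗ[ℂ] dX := S.R.comp S.bbFst

lemma bbA₀_eq_restrictKer : S.bbA₀ = restrictKer S.bbA S.boundaryMap := rfl

lemma calA_eq_coupledMatrix : S.calA = coupledMatrix S.bbA S.boundaryMap S.bbB S.B₄ := rfl

lemma toY_eq_iff (x : S.YinX) (y : Y) : S.toY x = y ↔ (x : X) = S.ι y :=
  (LinearEquiv.symm_apply_eq _).trans Subtype.ext_iff

lemma mem_graph_boundaryPair_bbA {y y' : Y} {x x' : X} {d d' z : dX} :
    ((y, x, d), ((y', x', d'), z)) ∈ (boundaryPair S.bbA S.boundaryMap).graph ↔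
      (y, (x', z)) ∈ S.AR.graph ∧ x = S.ι y' ∧ d' = z + S.B₂ y := by
  rw [mem_graph_boundaryPair, show S.AR = boundaryPair S.A S.R from rfl, mem_graph_boundaryPair]
  constructor
  · rintro ⟨h, hA, rfl⟩
    change (S.toY ⟨x, h.2.1⟩, S.A ⟨y, h.1⟩, S.L ⟨y, h.1⟩) = (y', x', d') at hA
    simp only [Prod.mk.injEq, toY_eq_iff] at hA
    exact ⟨⟨h.1, hA.2.1, rfl⟩, hA.1, hA.2.2.symm⟩
  · rintro ⟨⟨hy, rfl, rfl⟩, rfl, rfl⟩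
    exact ⟨⟨hy, ⟨y', rfl⟩, trivial⟩, Prod.ext ((S.toY_eq_iff _ _).2 rfl) rfl, rfl⟩

lemma isClosed_boundaryPair_bbA (h : S.AR.IsClosed) :
    (boundaryPair S.bbA S.boundaryMap).IsClosed := by
  have graph_eq : ((boundaryPair S.bbA S.boundaryMap).graph :
      Set ((Y × X × dX) × (Y × X × dX) × dX)) =
      {p | (p.1.1, (p.2.1.2.1, p.2.2)) ∈ S.AR.graph} ∩
        ({p | p.1.2.1 = S.ι p.2.1.1} ∩ {p | p.2.1.2.2 = p.2.2 + S.B₂ p.1.1}) :=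
    Set.ext fun _ => S.mem_graph_boundaryPair_bbA
  rw [LinearPMap.IsClosed, graph_eq]
  exact (IsClosed.preimage (by fun_prop) h).inter
    ((isClosed_eq (by fun_prop) (by fun_prop)).inter (isClosed_eq (by fun_prop) (by fun_prop)))

lemma boundaryMap_surjective (hR : Function.Surjective S.R) :
    Function.Surjective S.boundaryMap := by
  intro z
  obtain ⟨y, rfl⟩ := hR z
  exact ⟨⟨(y.1, 0, 0), y.2, Submodule.zero_mem _, trivial⟩, rfl⟩

lemma finrank_coker_boundaryMap (hR : Function.Surjective S.R) :
    finrank ℂ (dX ⧸ LinearMap.range S.boundaryMap) = 0 := by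
  rw [LinearMap.range_eq_top.2 (S.boundaryMap_surjective hR)]
  exact finrank_zero_of_subsingleton

end Data

end Acoustic

open Acoustic in
theorem proposition3p14_general {E Z : Type*}
    [NormedAddCommGroup E] [NormedSpace ℂ E] [CompleteSpace E]
    [NormedAddCommGroup Z] [NormedSpace ℂ Z] [FiniteDimensional ℂ Z]
    {A : E →ₗ.[ℂ] E} {R : A.domain →ₗ[ℂ] Z} (hAR : (boundaryPair A R).IsClosed)
    (B : E →L[ℂ] Z) (C : Z →L[ℂ] Z) :
    essentialSpectrum (coupledMatrix A R B C) = essentialSpectrum (restrictKer A R) ∧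
      ∀ μ : ℂ, μ ∉ essentialSpectrum (restrictKer A R) →
        fredholmIndex (subScalar (coupledMatrix A R B C) μ) +
            Module.finrank ℂ (Z ⧸ LinearMap.range R) =
          fredholmIndex (subScalar (restrictKer A R) μ) := by
  refine ⟨Set.ext fun μ => not_congr ?_, fun μ hμ => ?_⟩
  · rw [subScalar_coupledMatrix, subScalar_restrictKer]
    exact isFredholm_coupledMatrix_iff (isClosed_boundaryPair_subScalar hAR μ)
  · rw [subScalar_coupledMatrix]
    exact fredholmIndex_coupledMatrix_add (not_not.1 hμ)

theorem proposition3p14 {X Y dX : Type*}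
    [NormedAddCommGroup X] [NormedSpace ℂ X] [CompleteSpace X]
    [NormedAddCommGroup Y] [NormedSpace ℂ Y] [CompleteSpace Y]
    [NormedAddCommGroup dX] [NormedSpace ℂ dX] [CompleteSpace dX]
    (S : Acoustic.Data X Y dX) (hS : S.Assumptions) (hdX : FiniteDimensional ℂ dX) :
    Acoustic.essentialSpectrum S.calA = Acoustic.essentialSpectrum S.bbA₀ ∧
      ∀ μ : ℂ, μ ∉ Acoustic.essentialSpectrum S.bbA₀ →
        Acoustic.fredholmIndex (Acoustic.subScalar S.calA μ) =
          Acoustic.fredholmIndex (Acoustic.subScalar S.bbA₀ μ) := by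
  rw [S.calA_eq_coupledMatrix, S.bbA₀_eq_restrictKer]
  simpa only [S.finrank_coker_boundaryMap hS.R_surjective, Nat.cast_zero, add_zero] using
    proposition3p14_general (S.isClosed_boundaryPair_bbA hS.AR_closed) S.bbB S.B₄
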